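/- For $K\ge 2$ and a family $\nu=(\nu_\ell)$ of probability distributions indexed by the $2^{K-1}$ leaves, let $\mathcal M_\nu$ be the following episodic Markov decision process with horizon $H=K$. Its states are the $S=2^K-1$ nodes of the complete binary tree with $K$ levels; each episode starts at the root; the two actions "left" and "right" lead deterministically to the left and right child; internal nodes have cost $0$, and each visit to a leaf $\ell$ incurs an independent cost with distribution $\nu_\ell$. For a policy $\pi$ (a map from states to probability distributions on the two actions) let $\mu(\pi)$ be its expected total cost in one episode, and let $\pi^*$ be a minimizer of $\mu$. An episodic RL algorithm chooses the policy $\pi_n$ of episode $n$, possibly at random, based only on the policies, and the states, actions and costs observed, in episodes $1,\dots,n-1$ (it may know the tree, $K$ and $N$, but not $\nu$). Its cumulative regret after $N$ episodes is $R_N=\sum_{n=1}^N\big(\mu(\pi_n)-\mu(\pi^*)\big)$. Theorem. There is a universal constant $c>0$ such that for all integers $K\ge 2$ and $N\ge 0$ and for every episodic RL algorithm there are leaf cost distributions $\nu_\ell$ supported in $[0,1]$ for which, on $\mathcal M_\nu$, $$\mathbb E[R_N]\ \ge\ c\,\min\{\sqrt{SN},\,N\}.$$ In particular $\mathbb E[R_N]\ge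 c\sqrt{SN}$ whenever $N\ge S$. The expectation is over the random costs, the random actions of the policies and the internal randomness of the algorithm. -/

import Mathlib

open MeasureTheory ProbabilityTheory
open scoped ENNReal

namespace EpisodicRL

/-- A finite-horizon Markov decision process with state set `S`, action set `A` and horizon `H`.
The time steps `1, …, H` are indexed by `Fin H`. -/
structure MDP (S A : Type) (H : ℕ) where
  /-- the initial state distribution -/
  init : PMF S
  /-- `trans t s a` is the law of the state at step `t + 1` when action `a` is taken in state `s`
  at step `t` -/
  trans : Fin H → S → A → PMF S
  /-- `cost t s a` is the law of the random cost of taking action `a` in state `s` at step `t` -/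
  cost : Fin H → S → A → ProbabilityMeasure ℝ

/-- A (stochastic) policy: a probability vector over actions for every state. Deterministic policies
are the ones whose probability vectors are vertices of the simplex. -/
abbrev Policy (S A : Type) [Fintype A] : Type := S → stdSimplex ℝ A

/-- The state-action sequence of an episode. -/
abbrev Path (S A : Type) (H : ℕ) : Type := Fin H → S × A

/-- What is observed in an episode: the states, the actions and the realised costs. -/
abbrev Episode (S A : Type) (H : ℕ) : Type := Path S A H × (Fin H → ℝ)

/-- The history of `n` episodes: the policies that were run, and what was observed. -/
abbrev History (S A : Type) [Fintype A] (H n : ℕ) : Type := Fin n → Policy S A × Episode S A H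

/-- An episodic RL algorithm: before episode `n` it selects a policy, as a (possibly randomised)
measurable function of the policies and the observations of the previous episodes. -/
structure Algorithm (S A : Type) [Fintype A] [MeasurableSpace S] [MeasurableSpace A] (H : ℕ) where
  /-- the conditional law of the policy of the next episode, given the history of `n` episodes -/
  next : (n : ℕ) → Kernel (History S A H n) (Policy S A)
  /-- the conditional laws are probability measures -/
  markov : ∀ n, IsMarkovKernel (next n)

namespace MDP

variable {S A : Type} {H : ℕ} [Fintype A]

/-- The probability of being in the state of the path `ξ` at step `t`, given the previous
state and action of `ξ` (at the first step: under the initial distribution). -/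
noncomputable def arrivalProb (M : MDP S A H) (ξ : Path S A H) (t : Fin H) : ℝ≥0∞ :=
  if (t : ℕ) = 0 then M.init (ξ t).1
  else
    let u : Fin H := ⟨(t : ℕ) - 1, lt_of_le_of_lt (Nat.sub_le _ _) t.isLt⟩
    M.trans u (ξ u).1 (ξ u).2 (ξ t).1

/-- The probability of the path `(s₁, a₁, …, s_H, a_H)` under the policy `π`, that is
`ρ₀(s₁) π(a₁|s₁) P₁(s₂|s₁,a₁) π(a₂|s₂) ⋯ P_{H-1}(s_H|s_{H-1},a_{H-1}) π(a_H|s_H)`. -/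
noncomputable def pathProb (M : MDP S A H) (π : Policy S A) (ξ : Path S A H) : ℝ≥0∞ :=
  ∏ t : Fin H, M.arrivalProb ξ t * ENNReal.ofReal ((π (ξ t).1).1 (ξ t).2)

/-- The expected cost of taking action `a` in state `s` at step `t`. -/
noncomputable def meanCost (M : MDP S A H) (t : Fin H) (s : S) (a : A) : ℝ :=
  ∫ x, x ∂(M.cost t s a : Measure ℝ)

theorem measurable_pathProb (M : MDP S A H) (ξ : Path S A H) :
    Measurable fun π : Policy S A => M.pathProb π ξ := by
  unfold pathProb
  refine Finset.measurable_prod _ fun t _ => ?_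
  refine measurable_const.mul (ENNReal.measurable_ofReal.comp ?_)
  exact (measurable_pi_apply (ξ t).2).comp
    (measurable_subtype_coe.comp (measurable_pi_apply (ξ t).1))

variable [Fintype S]

/-- The expected total cost `μ(π)` of an episode under the policy `π`. -/
noncomputable def value (M : MDP S A H) (π : Policy S A) : ℝ :=
  ∑ ξ : Path S A H, (M.pathProb π ξ).toReal * ∑ t : Fin H, M.meanCost t (ξ t).1 (ξ t).2

variable [MeasurableSpace S] [MeasurableSpace A]

/-- The law of an episode as a function of the policy that is run: the path has probability
`pathProb`, and given the path the costs are drawn independently. -/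
noncomputable def episodeKernel (M : MDP S A H) : Kernel (Policy S A) (Episode S A H) where
  toFun π := ∑ ξ : Path S A H, M.pathProb π ξ •
    (Measure.dirac ξ).prod
      (Measure.pi fun t : Fin H => (M.cost t (ξ t).1 (ξ t).2 : Measure ℝ))
  measurable' := by
    refine Measure.measurable_of_measurable_coe _ fun s _ => ?_
    simp only [Measure.coe_finsetSum, Finset.sum_apply, Measure.smul_apply, smul_eq_mul]
    exact Finset.measurable_sum _ fun ξ _ => (M.measurable_pathProb ξ).mul_const _

/-- The joint law of the first `n` policies and episodes when `alg` interacts with `M`: given the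
past, the next policy is drawn by the algorithm, and it is then run for one episode. -/
noncomputable def historyLaw (M : MDP S A H) (alg : Algorithm S A H) :
    (n : ℕ) → Measure (History S A H n)
  | 0 => Measure.dirac (fun i => i.elim0)
  | n + 1 =>
      (M.historyLaw alg n ⊗ₘ
        (alg.next n ⊗ₖ Kernel.prodMkLeft (History S A H n) M.episodeKernel)).map
      fun p => (Fin.snoc (α := fun _ => Policy S A × Episode S A H) p.1 p.2 :
        History S A H (n + 1))

/-- The expected cumulative regret `E[∑_{n ≤ N} (μ(πₙ) - μ(π⋆))]` of `alg` over `N` episodes,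
relative to the policy `πstar`. -/
noncomputable def expectedRegret (M : MDP S A H) (alg : Algorithm S A H) (πstar : Policy S A)
    (N : ℕ) : ℝ :=
  ∫ h : History S A H N, ∑ n : Fin N, (M.value (h n).1 - M.value πstar) ∂(M.historyLaw alg N)

/-- `πstar` minimises the expected total cost among all policies. -/
def IsOptimal (M : MDP S A H) (πstar : Policy S A) : Prop :=
  ∀ π : Policy S A, M.value πstar ≤ M.value π

end MDP

/-- The nodes of the complete binary tree with `K` levels, in breadth-first order: the root is `0`
and the children of `s` are `2 * s + 1` (left) and `2 * s + 2` (right). -/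
abbrev TreeState (K : ℕ) : Type := Fin (2 ^ K - 1)

/-- The node `s` has no children. -/
def IsLeaf (K : ℕ) (s : TreeState K) : Prop := 2 ^ K - 1 ≤ 2 * (s : ℕ) + 1

instance (K : ℕ) (s : TreeState K) : Decidable (IsLeaf K s) :=
  inferInstanceAs (Decidable (_ ≤ _))

/-- The left child (`a = false`) or the right child (`a = true`) of a node; leaves, where an episode
ends, are mapped to themselves. -/
def child (K : ℕ) (s : TreeState K) (a : Bool) : TreeState K :=
  if h : 2 * (s : ℕ) + 1 + a.toNat < 2 ^ K - 1 then ⟨2 * (s : ℕ) + 1 + a.toNat, h⟩ else s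

/-- The binary-tree MDP of depth `K`: deterministic transitions, starting at the root, with zero
cost at the inner nodes and random cost with law `ν l` at the leaf `l`. -/
noncomputable def treeMDP (K : ℕ) (hK : 1 < K)
    (ν : {s : TreeState K // IsLeaf K s} → ProbabilityMeasure ℝ) :
    MDP (TreeState K) Bool K where
  init := PMF.pure
    ⟨0, Nat.sub_pos_of_lt (Nat.one_lt_two_pow (Nat.ne_of_gt (Nat.lt_trans Nat.zero_lt_one hK)))⟩
  trans _ s a := PMF.pure (child K s a)
  cost _ s _ := if h : IsLeaf K s then ν ⟨s, h⟩ else ⟨Measure.dirac 0, inferInstance⟩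

end EpisodicRL

/-! The hard instances hide one good leaf among the `L` leaves: every leaf cost is a fair coin,
except that one leaf `l` has mean `1/2 - ε`. An optimal policy walks to `l`, and each episode ending
elsewhere loses `ε` in mean. So the regret is `ε (N - E_l[T_l])`, where `T_l` sums the probabilities
with which the chosen policies reach `l`, and it suffices to find a leaf with `E_l[T_l] ≤ 3N/4`
(`exists_expectedVisits_le`).

Each planted instance is compared with the null instance, where all leaves are fair. The dynamics
and the algorithm are common to both, so the likelihood ratio `Z` of two history laws involves only
costs seen at `l`. Hence the relative entropy of the null law with respect to the planted one is
`coinEntropy ε * E_0[T_l]`, of order `ε² E_0[T_l]` (`integral_log_historyLikelihood`). As `0 ≤ T_l ≤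
N`, the difference `E_l[T_l] - E_0[T_l]` is at most `N E_0|Z - 1|`, which the entropy controls
(`HasCostDensity.integral_sum_le`).

Under the null law the `T_l` sum to `N`, so a typical leaf has `E_0[T_l]` about `N / L` and stays
undetected while `ε² N` is at most a small multiple of `L`. Since `S ≤ 2L`, this permits `ε` of
order `min (√(S/N)) 1`, and the regret `ε N / 4` has the claimed order. -/

namespace EpisodicRL

/-! ### Product densities and Markov trajectories -/

/-- A product of measures with densities has the product of the densities as its density. -/
theorem pi_withDensity {ι : Type*} [Fintype ι] {α : ι → Type*} [∀ i, MeasurableSpace (α i)]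
    (μ : ∀ i, Measure (α i)) [∀ i, IsProbabilityMeasure (μ i)] (f : ∀ i, α i → ℝ≥0∞)
    (hf : ∀ i, Measurable (f i)) [∀ i, IsProbabilityMeasure ((μ i).withDensity (f i))] :
    Measure.pi (fun i => (μ i).withDensity (f i)) =
      (Measure.pi μ).withDensity fun x => ∏ i, f i (x i) := by
  refine Measure.pi_eq fun s hs => ?_
  rw [withDensity_apply _ (MeasurableSet.univ_pi hs), ← lintegral_indicator
    (MeasurableSet.univ_pi hs)]
  have h1 : ∀ x : ∀ i, α i, (Set.univ.pi s).indicator (fun x => ∏ i, f i (x i)) x =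
      ∏ i, (s i).indicator (f i) (x i) := by
    intro x
    by_cases hx : x ∈ Set.univ.pi s
    · rw [Set.indicator_of_mem hx]
      exact Finset.prod_congr rfl fun i _ => (Set.indicator_of_mem (hx i trivial) _).symm
    · rw [Set.indicator_of_notMem hx]
      simp only [Set.mem_pi, Set.mem_univ, true_implies, not_forall] at hx
      obtain ⟨i, hi⟩ := hx
      exact (Finset.prod_eq_zero (Finset.mem_univ i) (Set.indicator_of_notMem hi _)).symm
  simp_rw [h1]
  -- The indicator of a box factorises, so independence of the coordinates turns the integral into a
  -- product.
  have h2 := lintegral_prod_eq_prod_lintegral_of_indepFun (μ := Measure.pi μ) Finset.univ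
    (fun i (x : ∀ i, α i) => (s i).indicator (f i) (x i))
    (iIndepFun_pi (X := fun i => (s i).indicator (f i))
      fun i => ((hf i).indicator (hs i)).aemeasurable)
    (fun i => ((hf i).indicator (hs i)).comp (measurable_pi_apply i))
  rw [h2]
  refine Finset.prod_congr rfl fun i _ => ?_
  rw [(measurePreserving_eval μ i).lintegral_comp ((hf i).indicator (hs i)),
    lintegral_indicator (hs i), withDensity_apply _ (hs i)]

/-- The total mass of the trajectories of length `n` of an inhomogeneous Markov chain is one. -/
theorem sum_prod_markov {X : Type*} [Fintype X] (n : ℕ) :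
    ∀ (k : ℕ → X → X → ℝ≥0∞) (_ : ∀ t x, ∑ y, k t x y = 1) (x₀ : X),
      ∑ ξ : Fin n → X, ∏ t : Fin n,
        k t (Fin.cons (α := fun _ => X) x₀ ξ t.castSucc) (ξ t) = 1 := by
  induction n with
  | zero => intro k _ x₀; simp
  | succ n ih =>
    intro k hk x₀
    rw [← (Fin.consEquiv fun _ : Fin (n + 1) => X).sum_comp, Fintype.sum_prod_type]
    rw [← hk 0 x₀]
    refine Finset.sum_congr rfl fun y _ => ?_
    have := ih (fun t => k (t + 1)) (fun t => hk (t + 1)) y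
    simp only [Fin.consEquiv, Equiv.coe_fn_mk, Fin.prod_univ_succ, Fin.castSucc_zero,
      Fin.cons_zero, Fin.val_zero, ← Fin.succ_castSucc, Fin.cons_succ, Fin.val_succ]
    rw [← Finset.mul_sum, this, mul_one]

/-! ### Laws of episodes and histories -/

namespace MDP

variable {S A : Type} {H : ℕ} [Fintype A] [Fintype S]

theorem sum_pathProb (M : MDP S A H) (π : Policy S A) : ∑ ξ : Path S A H, M.pathProb π ξ = 1 := by
  rcases Nat.eq_zero_or_pos H with rfl | hH
  · simp [pathProb]
  have hpol : ∀ s, ∑ a, ENNReal.ofReal ((π s).1 a) = 1 := fun s => by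
    rw [← ENNReal.ofReal_sum_of_nonneg fun a _ => (π s).2.1 a, (π s).2.2, ENNReal.ofReal_one]
  have hpmf : ∀ p : PMF S, ∑ s, p s = 1 := fun p => by
    rw [← tsum_fintype (L := .unconditional _), p.tsum_coe]
  obtain ⟨s₀⟩ : Nonempty S := by
    obtain ⟨s, _⟩ := M.init.support_nonempty
    exact ⟨s⟩
  obtain ⟨a₀⟩ : Nonempty A := by
    by_contra h
    rw [not_nonempty_iff] at h
    simpa using hpol s₀
  -- The path is a Markov chain on state-action pairs. The first step ignores its dummy predecessor
  -- `(s₀, a₀)`; the value for `t - 1 ≥ H` is never used and only keeps `k` stochastic at all times.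
  let k : ℕ → S × A → S × A → ℝ≥0∞ := fun t x y =>
    (if t = 0 then M.init y.1 else
      if h : t - 1 < H then M.trans ⟨t - 1, h⟩ x.1 x.2 y.1 else M.init y.1) *
      ENNReal.ofReal ((π y.1).1 y.2)
  have hk : ∀ t x, ∑ y, k t x y = 1 := by
    intro t x
    simp only [k, Fintype.sum_prod_type, ← Finset.mul_sum, hpol, mul_one]
    split_ifs <;> exact hpmf _
  rw [← sum_prod_markov H k hk (s₀, a₀)]
  refine Finset.sum_congr rfl fun ξ _ => Finset.prod_congr rfl fun t _ => ?_
  simp only [k, arrivalProb]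
  congr 1
  by_cases ht : (t : ℕ) = 0
  · simp [ht]
  · have hlt : (t : ℕ) - 1 < H := by omega
    have : t.castSucc = (⟨(t : ℕ) - 1, hlt⟩ : Fin H).succ := by
      ext; simp; omega
    simp only [ht, if_false, hlt, dif_pos]
    rw [this, Fin.cons_succ]

theorem pathProb_ne_top (M : MDP S A H) (π : Policy S A) (ξ : Path S A H) :
    M.pathProb π ξ ≠ ∞ := by
  refine ne_top_of_le_ne_top ENNReal.one_ne_top ?_
  rw [← M.sum_pathProb π]
  exact Finset.single_le_sum (f := fun ξ => M.pathProb π ξ) (fun _ _ => zero_le) (Finset.mem_univ ξ)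

theorem sum_toReal_pathProb (M : MDP S A H) (π : Policy S A) :
    ∑ ξ : Path S A H, (M.pathProb π ξ).toReal = 1 := by
  rw [← ENNReal.toReal_sum fun ξ _ => M.pathProb_ne_top π ξ, sum_pathProb, ENNReal.toReal_one]

variable [MeasurableSpace S] [MeasurableSpace A]

theorem episodeKernel_apply (M : MDP S A H) (π : Policy S A) :
    M.episodeKernel π = ∑ ξ : Path S A H, M.pathProb π ξ •
      (Measure.dirac ξ).prod
        (Measure.pi fun t : Fin H => (M.cost t (ξ t).1 (ξ t).2 : Measure ℝ)) := rfl

instance (M : MDP S A H) : IsMarkovKernel M.episodeKernel := ⟨fun π => ⟨by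
  rw [episodeKernel_apply]
  simp [sum_pathProb]⟩⟩

instance (alg : Algorithm S A H) (n : ℕ) : IsMarkovKernel (alg.next n) := alg.markov n

omit [Fintype S] in
theorem measurable_snoc (n : ℕ) :
    Measurable fun p : History S A H n × (Policy S A × Episode S A H) =>
      (Fin.snoc (α := fun _ => Policy S A × Episode S A H) p.1 p.2 : History S A H (n + 1)) := by
  refine measurable_pi_iff.2 fun i => ?_
  induction i using Fin.lastCases with
  | last => simpa using measurable_snd
  | cast i =>
    simp only [Fin.snoc_castSucc]
    exact (measurable_pi_apply i).comp measurable_fst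

instance (M : MDP S A H) (alg : Algorithm S A H) (n : ℕ) :
    IsProbabilityMeasure (M.historyLaw alg n) := by
  induction n with
  | zero => exact inferInstanceAs (IsProbabilityMeasure (Measure.dirac _))
  | succ n ih => exact Measure.isProbabilityMeasure_map (measurable_snoc n).aemeasurable

/-- The conditional law of the next policy and episode, given the history. -/
noncomputable def stepKernel (M : MDP S A H) (alg : Algorithm S A H) (n : ℕ) :
    Kernel (History S A H n) (Policy S A × Episode S A H) :=
  alg.next n ⊗ₖ Kernel.prodMkLeft (History S A H n) M.episodeKernel

instance (M : MDP S A H) (alg : Algorithm S A H) (n : ℕ) : IsMarkovKernel (M.stepKernel alg n) :=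
  inferInstanceAs (IsMarkovKernel (_ ⊗ₖ _))

theorem lintegral_stepKernel (M : MDP S A H) (alg : Algorithm S A H) (n : ℕ)
    (h : History S A H n) {f : Policy S A × Episode S A H → ℝ≥0∞} (hf : Measurable f) :
    ∫⁻ p, f p ∂M.stepKernel alg n h =
      ∫⁻ π, ∫⁻ e, f (π, e) ∂M.episodeKernel π ∂alg.next n h := by
  rw [stepKernel, Kernel.lintegral_compProd _ _ _ hf]
  rfl

theorem integral_stepKernel (M : MDP S A H) (alg : Algorithm S A H) (n : ℕ)
    (h : History S A H n) {f : Policy S A × Episode S A H → ℝ} (hf : Measurable f) {C : ℝ}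
    (hC : ∀ p, |f p| ≤ C) :
    ∫ p, f p ∂M.stepKernel alg n h =
      ∫ π, ∫ e, f (π, e) ∂M.episodeKernel π ∂alg.next n h := by
  have hi : Integrable f ((alg.next n ⊗ₖ Kernel.prodMkLeft (History S A H n) M.episodeKernel) h) :=
    .of_bound hf.aestronglyMeasurable C (.of_forall hC)
  rw [stepKernel, ProbabilityTheory.integral_compProd hi]
  rfl

theorem lintegral_historyLaw_succ (M : MDP S A H) (alg : Algorithm S A H) (n : ℕ)
    {f : History S A H (n + 1) → ℝ≥0∞} (hf : Measurable f) :
    ∫⁻ h, f h ∂M.historyLaw alg (n + 1) =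
      ∫⁻ h, ∫⁻ p, f (Fin.snoc (α := fun _ => Policy S A × Episode S A H) h p)
        ∂M.stepKernel alg n h ∂M.historyLaw alg n := by
  have hm := measurable_snoc (S := S) (A := A) (H := H) n
  have hfm := hf.comp hm
  simp only [Function.comp_def] at hfm
  rw [historyLaw, lintegral_map hf hm, Measure.lintegral_compProd hfm]
  rfl

theorem integral_historyLaw_succ (M : MDP S A H) (alg : Algorithm S A H) (n : ℕ)
    {f : History S A H (n + 1) → ℝ} (hf : Measurable f) {C : ℝ} (hC : ∀ h, |f h| ≤ C) :
    ∫ h, f h ∂M.historyLaw alg (n + 1) =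
      ∫ h, ∫ p, f (Fin.snoc (α := fun _ => Policy S A × Episode S A H) h p)
        ∂M.stepKernel alg n h ∂M.historyLaw alg n := by
  have hm := measurable_snoc (S := S) (A := A) (H := H) n
  have hfm := hf.comp hm
  simp only [Function.comp_def] at hfm
  rw [historyLaw, integral_map hm.aemeasurable hf.aestronglyMeasurable]
  exact Measure.integral_compProd (.of_bound hfm.aestronglyMeasurable C (.of_forall fun x => hC _))

/-- Centred increments of the history have a centred sum. -/
theorem integral_sum_history_eq_zero (M : MDP S A H) (alg : Algorithm S A H)
    {φ : Policy S A × Episode S A H → ℝ} (hφ : Measurable φ) {C : ℝ} (hC : ∀ x, |φ x| ≤ C)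
    (h0 : ∀ π, ∫ e, φ (π, e) ∂M.episodeKernel π = 0) (n : ℕ) :
    ∫ h, ∑ i : Fin n, φ (h i) ∂M.historyLaw alg n = 0 := by
  induction n with
  | zero => simp
  | succ n ih =>
    have hm : Measurable fun h : History S A H (n + 1) => ∑ i, φ (h i) :=
      Finset.measurable_sum _ fun i _ => hφ.comp (measurable_pi_apply i)
    have hb : ∀ h : History S A H (n + 1), |∑ i, φ (h i)| ≤ (n + 1 : ℕ) * C := fun h => by
      refine (Finset.abs_sum_le_sum_abs _ _).trans ((Finset.sum_le_sum fun i _ => hC (h i)).trans ?_)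
      simp
    rw [M.integral_historyLaw_succ alg n hm hb, ← ih]
    refine integral_congr_ae (.of_forall fun h => ?_)
    simp only [Fin.sum_univ_castSucc, Fin.snoc_castSucc, Fin.snoc_last]
    rw [integral_add (integrable_const _)
      (.of_bound hφ.aestronglyMeasurable C (.of_forall fun x => hC _)),
      M.integral_stepKernel alg n h hφ hC]
    simp [h0]

theorem lintegral_episodeKernel [DiscreteMeasurableSpace (Path S A H)] (M : MDP S A H)
    (π : Policy S A) {f : Episode S A H → ℝ≥0∞} (hf : Measurable f) :
    ∫⁻ e, f e ∂M.episodeKernel π = ∑ ξ : Path S A H, M.pathProb π ξ *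
      ∫⁻ x, f (ξ, x) ∂Measure.pi fun t : Fin H => (M.cost t (ξ t).1 (ξ t).2 : Measure ℝ) := by
  rw [episodeKernel_apply, lintegral_finsetSum_measure]
  refine Finset.sum_congr rfl fun ξ _ => ?_
  rw [lintegral_smul_measure, lintegral_prod _ hf.aemeasurable, lintegral_dirac, smul_eq_mul]

theorem integral_episodeKernel [DiscreteMeasurableSpace (Path S A H)] (M : MDP S A H)
    (π : Policy S A) {f : Episode S A H → ℝ} (hf : Measurable f) {C : ℝ} (hC : ∀ e, |f e| ≤ C) :
    ∫ e, f e ∂M.episodeKernel π = ∑ ξ : Path S A H, (M.pathProb π ξ).toReal *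
      ∫ x, f (ξ, x) ∂Measure.pi fun t : Fin H => (M.cost t (ξ t).1 (ξ t).2 : Measure ℝ) := by
  have hi : ∀ ξ : Path S A H, Integrable f ((Measure.dirac ξ).prod
      (Measure.pi fun t : Fin H => (M.cost t (ξ t).1 (ξ t).2 : Measure ℝ))) := fun ξ =>
    .of_bound hf.aestronglyMeasurable C (.of_forall hC)
  rw [episodeKernel_apply, integral_finsetSum_measure fun ξ _ =>
    (hi ξ).smul_measure (M.pathProb_ne_top π ξ)]
  refine Finset.sum_congr rfl fun ξ _ => ?_
  rw [integral_smul_measure, integral_prod _ (hi ξ), integral_dirac, smul_eq_mul]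

end MDP

/-! ### Change of measure between MDPs with different cost laws -/

namespace MDP

variable {S A : Type} {H : ℕ} [Fintype A]

/-- `M₁` differs from `M₀` only in its cost laws, which have the densities `g s` with respect to
those of `M₀`. The densities are bounded away from `0` and `∞`. -/
structure HasCostDensity (M₀ M₁ : MDP S A H) (g : S → ℝ → ℝ) (B : ℝ) : Prop where
  init_eq : M₁.init = M₀.init
  trans_eq : M₁.trans = M₀.trans
  measurable : ∀ s, Measurable (g s)
  pos : ∀ s x, 0 < g s x
  abs_log_le : ∀ s x, |Real.log (g s x)| ≤ B
  cost_eq : ∀ t s a, (M₁.cost t s a : Measure ℝ) =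
    (M₀.cost t s a : Measure ℝ).withDensity fun x => ENNReal.ofReal (g s x)

/-- The likelihood ratio of an episode. -/
noncomputable def likelihood (g : S → ℝ → ℝ) (e : Episode S A H) : ℝ :=
  ∏ t : Fin H, g (e.1 t).1 (e.2 t)

/-- The expected sum of the weights `w` of the states that are visited in an episode. -/
noncomputable def occupation [Fintype S] (M : MDP S A H) (w : S → ℝ) (π : Policy S A) : ℝ :=
  ∑ ξ : Path S A H, (M.pathProb π ξ).toReal * ∑ t : Fin H, w (ξ t).1

theorem measurable_occupation [Fintype S] (M : MDP S A H) (w : S → ℝ) :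
    Measurable (M.occupation w) :=
  Finset.measurable_sum _ fun ξ _ => (M.measurable_pathProb ξ).ennreal_toReal.mul_const _

theorem abs_occupation_le [Fintype S] (M : MDP S A H) {w : S → ℝ} {C : ℝ} (hw : ∀ s, |w s| ≤ C)
    (π : Policy S A) : |M.occupation w π| ≤ H * C := by
  have h : ∀ ξ : Path S A H, |∑ t : Fin H, w (ξ t).1| ≤ H * C := fun ξ =>
    (Finset.abs_sum_le_sum_abs _ _).trans ((Finset.sum_le_sum fun t _ => hw _).trans (by simp))
  calc |M.occupation w π| ≤ ∑ ξ : Path S A H, (M.pathProb π ξ).toReal * (H * C) := by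
        refine (Finset.abs_sum_le_sum_abs _ _).trans (Finset.sum_le_sum fun ξ _ => ?_)
        rw [abs_mul, abs_of_nonneg ENNReal.toReal_nonneg]
        exact mul_le_mul_of_nonneg_left (h ξ) ENNReal.toReal_nonneg
    _ = H * C := by rw [← Finset.sum_mul, sum_toReal_pathProb, one_mul]

namespace HasCostDensity

variable {M₀ M₁ : MDP S A H} {g : S → ℝ → ℝ} {B : ℝ}

theorem pathProb_eq (hM : HasCostDensity M₀ M₁ g B) : M₁.pathProb = M₀.pathProb := by
  funext π ξ
  simp only [pathProb, arrivalProb, hM.init_eq, hM.trans_eq]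

omit [Fintype A] in
theorem likelihood_pos (hM : HasCostDensity M₀ M₁ g B) (e : Episode S A H) :
    0 < likelihood g e := Finset.prod_pos fun _ _ => hM.pos _ _

omit [Fintype A] in
theorem log_likelihood (hM : HasCostDensity M₀ M₁ g B) (e : Episode S A H) :
    Real.log (likelihood g e) = ∑ t : Fin H, Real.log (g (e.1 t).1 (e.2 t)) :=
  Real.log_prod fun _ _ => (hM.pos _ _).ne'

omit [Fintype A] in
theorem abs_log_likelihood_le (hM : HasCostDensity M₀ M₁ g B) (e : Episode S A H) :
    |Real.log (likelihood g e)| ≤ H * B := by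
  rw [hM.log_likelihood]
  exact (Finset.abs_sum_le_sum_abs _ _).trans
    ((Finset.sum_le_sum fun t _ => hM.abs_log_le _ _).trans (by simp))

variable [Fintype S] [MeasurableSpace S] [MeasurableSpace A]

variable [DiscreteMeasurableSpace S]

omit [Fintype A] in
theorem measurable_likelihood (hM : HasCostDensity M₀ M₁ g B) :
    Measurable (likelihood (S := S) (A := A) (H := H) g) := by
  have hg : Measurable fun p : S × ℝ => g p.1 p.2 :=
    measurable_from_prod_countable_right hM.measurable
  refine Finset.measurable_prod _ fun t _ => hg.comp (.prodMk ?_ ?_)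
  · exact measurable_fst.comp ((measurable_pi_apply t).comp measurable_fst)
  · exact (measurable_pi_apply t).comp measurable_snd

variable [DiscreteMeasurableSpace A]

/-- Path probabilities agree in the two models, and given the path the costs are independent, so
their densities multiply to `likelihood`. -/
theorem lintegral_episodeKernel (hM : HasCostDensity M₀ M₁ g B) (π : Policy S A)
    {f : Episode S A H → ℝ≥0∞} (hf : Measurable f) :
    ∫⁻ e, f e ∂M₁.episodeKernel π =
      ∫⁻ e, ENNReal.ofReal (likelihood g e) * f e ∂M₀.episodeKernel π := by
  have hl := hM.measurable_likelihood (A := A) (H := H)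
  have hlf : Measurable fun e => ENNReal.ofReal (likelihood g e) * f e := hl.ennreal_ofReal.mul hf
  rw [M₁.lintegral_episodeKernel π hf, M₀.lintegral_episodeKernel π hlf, hM.pathProb_eq]
  refine Finset.sum_congr rfl fun ξ _ => ?_
  congr 1
  have : ∀ t : Fin H, IsProbabilityMeasure ((M₀.cost t (ξ t).1 (ξ t).2 : Measure ℝ).withDensity
      fun x => ENNReal.ofReal (g (ξ t).1 x)) := fun t => by
    rw [← hM.cost_eq]
    infer_instance
  have hgm : ∀ t : Fin H, Measurable fun x => ENNReal.ofReal (g (ξ t).1 x) := fun t =>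
    (hM.measurable _).ennreal_ofReal
  have hprod : Measurable fun x : Fin H → ℝ => ∏ t, ENNReal.ofReal (g (ξ t).1 (x t)) :=
    Finset.measurable_prod _ fun t _ => (hgm t).comp (measurable_pi_apply t)
  have hfξ : Measurable fun x => f (ξ, x) := hf.comp measurable_prodMk_left
  simp_rw [hM.cost_eq]
  rw [pi_withDensity _ _ hgm, lintegral_withDensity_eq_lintegral_mul _ hprod hfξ]
  refine lintegral_congr fun x => ?_
  simp only [Pi.mul_apply, likelihood]
  rw [ENNReal.ofReal_prod_of_nonneg fun t _ => (hM.pos _ _).le]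

omit [DiscreteMeasurableSpace A] in
theorem measurable_historyLikelihood (hM : HasCostDensity M₀ M₁ g B) (n : ℕ) :
    Measurable fun h : History S A H n => ∏ i, likelihood g (h i).2 :=
  Finset.measurable_prod _ fun i _ =>
    hM.measurable_likelihood.comp (measurable_snd.comp (measurable_pi_apply i))

/-- The algorithm's kernels are the same under both models and cancel; each new episode contributes
just its own likelihood factor. -/
theorem lintegral_historyLaw (hM : HasCostDensity M₀ M₁ g B) (alg : Algorithm S A H) (n : ℕ) :
    ∀ {f : History S A H n → ℝ≥0∞} (_ : Measurable f),
    ∫⁻ h, f h ∂M₁.historyLaw alg n =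
      ∫⁻ h, ENNReal.ofReal (∏ i, likelihood g (h i).2) * f h ∂M₀.historyLaw alg n := by
  induction n with
  | zero => intro f _; simp [historyLaw]
  | succ n ih =>
    intro f hf
    have hl := (hM.measurable_likelihood (A := A) (H := H)).ennreal_ofReal
    have hm := measurable_snoc (S := S) (A := A) (H := H) n
    have hfm := hf.comp hm
    simp only [Function.comp_def] at hfm
    have hlf : Measurable fun h : History S A H (n + 1) =>
        ENNReal.ofReal (∏ i, likelihood g (h i).2) * f h :=
      (hM.measurable_historyLikelihood (n + 1)).ennreal_ofReal.mul hf
    rw [M₁.lintegral_historyLaw_succ alg n hf, M₀.lintegral_historyLaw_succ alg n hlf,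
      ih hfm.lintegral_kernel_prod_right']
    refine lintegral_congr fun h => ?_
    have hfh : Measurable fun p => f (Fin.snoc (α := fun _ => Policy S A × Episode S A H) h p) :=
      hfm.comp measurable_prodMk_left
    have hlfh : Measurable fun p : Policy S A × Episode S A H => ENNReal.ofReal (likelihood g p.2) *
        f (Fin.snoc (α := fun _ => Policy S A × Episode S A H) h p) :=
      (hl.comp measurable_snd).mul hfh
    have key : ∫⁻ p, f (Fin.snoc (α := fun _ => Policy S A × Episode S A H) h p)
          ∂M₁.stepKernel alg n h =
        ∫⁻ p, ENNReal.ofReal (likelihood g p.2) *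
          f (Fin.snoc (α := fun _ => Policy S A × Episode S A H) h p) ∂M₀.stepKernel alg n h := by
      rw [M₁.lintegral_stepKernel alg n h hfh,
        M₀.lintegral_stepKernel alg n h hlfh]
      exact lintegral_congr fun π => hM.lintegral_episodeKernel π (hfh.comp measurable_prodMk_left)
    rw [key, ← lintegral_const_mul _ hlfh]
    refine lintegral_congr fun p => ?_
    simp only [Fin.prod_univ_castSucc, Fin.snoc_castSucc, Fin.snoc_last]
    rw [ENNReal.ofReal_mul (Finset.prod_nonneg fun i _ => (hM.likelihood_pos _).le), mul_assoc]

theorem historyLaw_eq_withDensity (hM : HasCostDensity M₀ M₁ g B) (alg : Algorithm S A H) (n : ℕ) :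
    M₁.historyLaw alg n = (M₀.historyLaw alg n).withDensity
      fun h => ENNReal.ofReal (∏ i, likelihood g (h i).2) := by
  ext s hs
  rw [withDensity_apply _ hs, ← lintegral_indicator_one hs,
    hM.lintegral_historyLaw alg n (measurable_one.indicator hs), ← lintegral_indicator hs]
  refine lintegral_congr fun h => ?_
  by_cases hh : h ∈ s <;> simp [hh]

theorem integral_historyLaw (hM : HasCostDensity M₀ M₁ g B) (alg : Algorithm S A H) (n : ℕ)
    (f : History S A H n → ℝ) :
    ∫ h, f h ∂M₁.historyLaw alg n =
      ∫ h, (∏ i, likelihood g (h i).2) * f h ∂M₀.historyLaw alg n := by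
  rw [hM.historyLaw_eq_withDensity, integral_withDensity_eq_integral_toReal_smul
    (hM.measurable_historyLikelihood n).ennreal_ofReal (.of_forall fun h => ENNReal.ofReal_lt_top)]
  refine integral_congr_ae (.of_forall fun h => ?_)
  simp only [smul_eq_mul]
  rw [ENNReal.toReal_ofReal (Finset.prod_nonneg fun i _ => (hM.likelihood_pos _).le)]

/-- The logarithm turns the likelihood into a sum over steps, so the relative entropy of an episode
adds up the entropies `d s` of the cost laws at the visited states. -/
theorem integral_log_likelihood (hM : HasCostDensity M₀ M₁ g B) {d : S → ℝ}
    (hd : ∀ t s a, ∫ x, -Real.log (g s x) ∂(M₀.cost t s a : Measure ℝ) = d s) (π : Policy S A) :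
    ∫ e, -Real.log (likelihood g e) ∂M₀.episodeKernel π = M₀.occupation d π := by
  have hl : Measurable fun e : Episode S A H => -Real.log (likelihood g e) :=
    hM.measurable_likelihood.log.neg
  rw [M₀.integral_episodeKernel π hl (C := H * B)
    fun e => by rw [abs_neg]; exact hM.abs_log_likelihood_le e]
  refine Finset.sum_congr rfl fun ξ _ => ?_
  congr 1
  simp only [hM.log_likelihood, ← Finset.sum_neg_distrib]
  have hm : ∀ t : Fin H, Measurable fun x => -Real.log (g (ξ t).1 x) := fun t =>
    (hM.measurable _).log.neg
  have hi : ∀ t : Fin H, Integrable (fun x : Fin H → ℝ => -Real.log (g (ξ t).1 (x t)))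
      (Measure.pi fun t => (M₀.cost t (ξ t).1 (ξ t).2 : Measure ℝ)) := fun t =>
    .of_bound ((hm t).comp (measurable_pi_apply t)).aestronglyMeasurable B
      (.of_forall fun x => by simpa using hM.abs_log_le _ _)
  rw [integral_finsetSum _ fun t _ => hi t]
  refine Finset.sum_congr rfl fun t _ => ?_
  rw [← hd t _ (ξ t).2]
  exact integral_comp_eval (μ := fun t : Fin H => (M₀.cost t (ξ t).1 (ξ t).2 : Measure ℝ))
    (hm t).aestronglyMeasurable

/-- Chain rule for the relative entropy, also known as divergence decomposition. Subtracting from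
each episode's log-likelihood term its conditional mean given the policy leaves martingale
differences, whose sum has mean zero. -/
theorem integral_log_historyLikelihood (hM : HasCostDensity M₀ M₁ g B) {d : S → ℝ}
    (hd : ∀ t s a, ∫ x, -Real.log (g s x) ∂(M₀.cost t s a : Measure ℝ) = d s) {D : ℝ}
    (hD : ∀ s, |d s| ≤ D) (alg : Algorithm S A H) (n : ℕ) :
    ∫ h, -Real.log (∏ i, likelihood g (h i).2) ∂M₀.historyLaw alg n =
      ∫ h, ∑ i : Fin n, M₀.occupation d (h i).1 ∂M₀.historyLaw alg n := by
  have hl := hM.measurable_likelihood (A := A) (H := H)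
  have ho := M₀.measurable_occupation d
  have hbl : ∀ e : Episode S A H, |-Real.log (likelihood g e)| ≤ H * B := fun e => by
    rw [abs_neg]; exact hM.abs_log_likelihood_le e
  have hbo := M₀.abs_occupation_le hD
  have h0 := M₀.integral_sum_history_eq_zero alg
    (φ := fun p => -Real.log (likelihood g p.2) - M₀.occupation d p.1)
    ((hl.comp measurable_snd).log.neg.sub (ho.comp measurable_fst)) (C := H * B + H * D)
    (fun p => (abs_sub _ _).trans (add_le_add (hbl _) (hbo _)))
    (fun π => by
      have hi : Integrable (fun e => -Real.log (likelihood g e)) (M₀.episodeKernel π) :=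
        .of_bound hl.log.neg.aestronglyMeasurable _ (.of_forall hbl)
      dsimp only
      rw [integral_sub hi (integrable_const _), hM.integral_log_likelihood hd]
      simp) n
  simp only [Finset.sum_sub_distrib] at h0
  rw [integral_sub] at h0
  · rw [← sub_eq_zero, ← h0]
    congr 1
    refine integral_congr_ae (.of_forall fun h => ?_)
    simp only [Finset.sum_neg_distrib]
    rw [Real.log_prod fun i _ => (hM.likelihood_pos _).ne']
  · refine integrable_finsetSum _ fun i _ => .of_bound
      (hl.log.neg.comp (measurable_snd.comp (measurable_pi_apply i))).aestronglyMeasurable _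
      (.of_forall fun h => hbl _)
  · refine integrable_finsetSum _ fun i _ => .of_bound
      (ho.comp (measurable_fst.comp (measurable_pi_apply i))).aestronglyMeasurable _
      (.of_forall fun h => hbo _)

end HasCostDensity

/-! ### From relative entropy to expectations of bounded statistics -/

/-- A total variation bound in terms of the relative entropy, in pointwise form. -/
theorem abs_sub_one_le_entropy {z r : ℝ} (hz : 0 < z) (hr : 0 < r) :
    |z - 1| ≤ r / 2 * (z - 1 - Real.log z) + (z + 1) / r := by
  have hs := Real.sq_sqrt hz.le
  have hp := Real.sqrt_pos.2 hz
  have hlog : Real.log z / 2 ≤ √z - 1 := by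
    rw [← Real.log_sqrt hz.le]
    exact Real.log_le_sub_one_of_pos hp
  -- Hellinger distance is the intermediary: its integrand is below the entropy integrand because
  -- `log √z ≤ √z - 1`. Then `|z - 1| = |√z - 1| (√z + 1)` is split by the weighted AM-GM inequality
  -- with weight `r`.
  have h1 : (√z - 1) ^ 2 ≤ z - 1 - Real.log z := by nlinarith
  have h2 : (√z + 1) ^ 2 ≤ 2 * (z + 1) := by nlinarith [sq_nonneg (√z - 1)]
  have h3 : |z - 1| = |√z - 1| * (√z + 1) := by
    rw [show z - 1 = (√z - 1) * (√z + 1) by linarith, abs_mul,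
      abs_of_pos (by linarith : 0 < √z + 1)]
  have h4 : |√z - 1| * (√z + 1) ≤ r / 2 * (√z - 1) ^ 2 + (√z + 1) ^ 2 / (2 * r) := by
    rw [← sq_abs (√z - 1), ← sub_nonneg]
    have : r / 2 * |√z - 1| ^ 2 + (√z + 1) ^ 2 / (2 * r) - |√z - 1| * (√z + 1) =
        (r * |√z - 1| - (√z + 1)) ^ 2 / (2 * r) := by
      field_simp
      ring
    rw [this]
    positivity
  have h5 : (√z + 1) ^ 2 / (2 * r) ≤ (z + 1) / r := by
    rw [div_le_div_iff₀ (by positivity) hr]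
    nlinarith
  rw [h3]
  have := mul_le_mul_of_nonneg_left h1 (by positivity : 0 ≤ r / 2)
  linarith

/-- The expectation of a bounded statistic of the policies changes little when the cost laws change
little. -/
theorem HasCostDensity.integral_sum_le [Fintype S] [MeasurableSpace S] [MeasurableSpace A]
    [DiscreteMeasurableSpace S] [DiscreteMeasurableSpace A] {M₀ M₁ : MDP S A H} {g : S → ℝ → ℝ}
    {B : ℝ} (hM : HasCostDensity M₀ M₁ g B) {d : S → ℝ}
    (hd : ∀ t s a, ∫ x, -Real.log (g s x) ∂(M₀.cost t s a : Measure ℝ) = d s) {D : ℝ}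
    (hD : ∀ s, |d s| ≤ D) (alg : Algorithm S A H) (n : ℕ) {T : Policy S A → ℝ}
    (hT : Measurable T) (hT0 : ∀ π, 0 ≤ T π) (hT1 : ∀ π, T π ≤ 1) {r : ℝ} (hr : 0 < r) :
    ∫ h, ∑ i : Fin n, T (h i).1 ∂M₁.historyLaw alg n ≤
      ∫ h, ∑ i : Fin n, T (h i).1 ∂M₀.historyLaw alg n +
      n * (r / 2 * ∫ h, ∑ i : Fin n, M₀.occupation d (h i).1 ∂M₀.historyLaw alg n + 2 / r) := by
  set P := M₀.historyLaw alg n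
  set Z : History S A H n → ℝ := fun h => ∏ i, likelihood g (h i).2
  set U : History S A H n → ℝ := fun h => ∑ i : Fin n, T (h i).1
  have hZm : Measurable Z := hM.measurable_historyLikelihood n
  have hZpos : ∀ h, 0 < Z h := fun h => Finset.prod_pos fun i _ => hM.likelihood_pos _
  have hlogb : ∀ h, |Real.log (Z h)| ≤ n * (H * B) := fun h => by
    rw [Real.log_prod fun i _ => (hM.likelihood_pos _).ne']
    exact (Finset.abs_sum_le_sum_abs _ _).trans
      ((Finset.sum_le_sum fun t _ => hM.abs_log_likelihood_le _).trans (by simp))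
  have hZb : ∀ h, ‖Z h‖ ≤ Real.exp (n * (H * B)) := fun h => by
    rw [Real.norm_of_nonneg (hZpos h).le, ← Real.log_le_iff_le_exp (hZpos h)]
    exact (le_abs_self _).trans (hlogb h)
  have hUm : Measurable U := Finset.measurable_sum _ fun i _ =>
    hT.comp (measurable_fst.comp (measurable_pi_apply i))
  have hU0 : ∀ h, 0 ≤ U h := fun h => Finset.sum_nonneg fun i _ => hT0 _
  have hU1 : ∀ h, U h ≤ n := fun h => (Finset.sum_le_sum fun i _ => hT1 _).trans (by simp)
  have hUb : ∀ h, ‖U h‖ ≤ n := fun h => by rw [Real.norm_of_nonneg (hU0 h)]; exact hU1 h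
  have hZi : Integrable Z P := .of_bound hZm.aestronglyMeasurable _ (.of_forall hZb)
  have hUi : Integrable U P := .of_bound hUm.aestronglyMeasurable _ (.of_forall hUb)
  have hLi : Integrable (fun h => -Real.log (Z h)) P :=
    .of_bound hZm.log.neg.aestronglyMeasurable _ (.of_forall fun h => by simpa using hlogb h)
  have hZ1 : ∫ h, Z h ∂P = 1 := by
    have := hM.integral_historyLaw alg n fun _ => 1
    simpa using this.symm
  have hZU : Integrable (fun h => Z h * U h) P := hZi.mul_bdd hUm.aestronglyMeasurable
    (.of_forall hUb)
  have hpt : ∀ h, Z h * U h ≤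
      U h + n * (r / 2 * ((Z h - 1) + -Real.log (Z h)) + (Z h + 1) * r⁻¹) := fun h => by
    have h1 := abs_sub_one_le_entropy (hZpos h) hr
    have h2 : (Z h - 1) * U h ≤ |Z h - 1| * n :=
      (mul_le_mul_of_nonneg_right (le_abs_self _) (hU0 h)).trans
        (mul_le_mul_of_nonneg_left (hU1 h) (abs_nonneg _))
    have h3 := mul_le_mul_of_nonneg_left h1 (Nat.cast_nonneg (α := ℝ) n)
    rw [div_eq_mul_inv (Z h + 1)] at h3
    linarith
  have hZ1i : Integrable (fun h => Z h - 1) P := hZi.sub (integrable_const 1)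
  have hE : Integrable (fun h => (Z h - 1) + -Real.log (Z h)) P :=
    hZ1i.add hLi
  have hF : Integrable (fun h => (Z h + 1) * r⁻¹) P := (hZi.add (integrable_const 1)).mul_const _
  have hR : Integrable (fun h => r / 2 * ((Z h - 1) + -Real.log (Z h)) + (Z h + 1) * r⁻¹) P :=
    (hE.const_mul _).add hF
  rw [hM.integral_historyLaw alg n]
  refine (integral_mono hZU (hUi.add (hR.const_mul _)) hpt).trans (le_of_eq ?_)
  -- Since `Z` has mean one, `Z - 1` integrates to `0` and `(Z + 1) / r` to `2 / r`; only the
  -- entropy term remains.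
  rw [← hM.integral_log_historyLikelihood hd hD alg n]
  simp only [Pi.add_apply]
  rw [integral_add hUi (hR.const_mul _), integral_const_mul, integral_add (hE.const_mul _) hF,
    integral_const_mul, integral_add hZ1i hLi,
    integral_sub hZi (integrable_const 1), integral_mul_const,
    integral_add hZi (integrable_const 1), hZ1]
  simp
  left
  ring

end MDP

/-! ### Fair and biased coins -/

/-- The law of a cost that is `1` with probability `p` and `0` otherwise. -/
noncomputable def coin (p : unitInterval) : ProbabilityMeasure ℝ :=
  ⟨ENNReal.ofReal p • Measure.dirac 1 + ENNReal.ofReal (1 - p) • Measure.dirac 0, ⟨by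
    simp [← ENNReal.ofReal_add p.2.1 (sub_nonneg.2 p.2.2)]⟩⟩

theorem coe_coin (p : unitInterval) : (coin p : Measure ℝ) =
    ENNReal.ofReal p • Measure.dirac 1 + ENNReal.ofReal (1 - p) • Measure.dirac 0 := rfl

theorem lintegral_coin (p : unitInterval) (f : ℝ → ℝ≥0∞) :
    ∫⁻ x, f x ∂(coin p : Measure ℝ) = ENNReal.ofReal p * f 1 + ENNReal.ofReal (1 - p) * f 0 := by
  simp [coe_coin, lintegral_add_measure]

theorem integral_coin (p : unitInterval) (f : ℝ → ℝ) :
    ∫ x, f x ∂(coin p : Measure ℝ) = p * f 1 + (1 - p) * f 0 := by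
  rw [coe_coin, integral_add_measure, integral_smul_measure, integral_smul_measure, integral_dirac,
    integral_dirac, ENNReal.toReal_ofReal p.2.1, ENNReal.toReal_ofReal (sub_nonneg.2 p.2.2)]
  · rfl
  · exact (integrable_dirac (by simp)).smul_measure ENNReal.ofReal_ne_top
  · exact (integrable_dirac (by simp)).smul_measure ENNReal.ofReal_ne_top

theorem coin_Icc (p : unitInterval) : (coin p : Measure ℝ) (Set.Icc 0 1) = 1 := by
  rw [← lintegral_indicator_one measurableSet_Icc, lintegral_coin]
  simp [← ENNReal.ofReal_add p.2.1 (sub_nonneg.2 p.2.2)]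

/-- The density of a coin with bias `1 / 2 - ε` with respect to the fair one. -/
noncomputable def coinDensity (ε x : ℝ) : ℝ := if x ≤ 1 / 2 then 1 + 2 * ε else 1 - 2 * ε

theorem measurable_coinDensity (ε : ℝ) : Measurable (coinDensity ε) :=
  Measurable.ite measurableSet_Iic measurable_const measurable_const

theorem coin_withDensity {p q : unitInterval} {ε : ℝ} (hp : (p : ℝ) = 1 / 2)
    (hq : (q : ℝ) = 1 / 2 - ε) : (coin q : Measure ℝ) =
      (coin p : Measure ℝ).withDensity fun x => ENNReal.ofReal (coinDensity ε x) := by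
  ext s hs
  have h1 : 0 ≤ 1 / 2 - ε := hq ▸ q.2.1
  rw [withDensity_apply _ hs, ← lintegral_indicator hs, ← lintegral_indicator_one hs,
    lintegral_coin, lintegral_coin, hp, hq]
  congr 1
  · by_cases h : (1 : ℝ) ∈ s
    · simp only [Set.indicator_of_mem h, Pi.one_apply, mul_one]
      rw [← ENNReal.ofReal_mul (by norm_num), coinDensity, if_neg (by norm_num)]
      congr 1
      ring
    · simp [h]
  · by_cases h : (0 : ℝ) ∈ s
    · simp only [Set.indicator_of_mem h, Pi.one_apply, mul_one]
      rw [← ENNReal.ofReal_mul (by norm_num), coinDensity, if_pos (by norm_num)]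
      congr 1
      ring
    · simp [h]

/-- The relative entropy of a fair coin with respect to one with bias `1 / 2 - ε`. -/
noncomputable def coinEntropy (ε : ℝ) : ℝ := -(Real.log (1 + 2 * ε) + Real.log (1 - 2 * ε)) / 2

theorem integral_log_coinDensity {p : unitInterval} (hp : (p : ℝ) = 1 / 2) (ε : ℝ) :
    ∫ x, -Real.log (coinDensity ε x) ∂(coin p : Measure ℝ) = coinEntropy ε := by
  rw [integral_coin, hp, coinDensity, coinDensity, if_neg (by norm_num), if_pos (by norm_num),
    coinEntropy]
  ring

/-- The entropy equals `-log (1 - 4ε²) / 2`, and `log x ≥ 1 - 1/x`. The restriction `ε ≤ 1/4` keeps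
`1 / (1 - 4ε²)` below `1 + 16/3 ε²`, with equality at the endpoint. -/
theorem coinEntropy_le {ε : ℝ} (h0 : 0 ≤ ε) (h1 : ε ≤ 1 / 4) : coinEntropy ε ≤ 8 / 3 * ε ^ 2 := by
  have hp : 0 < 1 - 4 * ε ^ 2 := by nlinarith
  have h := Real.one_sub_inv_le_log_of_pos hp
  have h2 : Real.log (1 + 2 * ε) + Real.log (1 - 2 * ε) = Real.log (1 - 4 * ε ^ 2) := by
    rw [← Real.log_mul (by linarith) (by linarith)]
    congr 1
    ring
  have h3 : (1 - 4 * ε ^ 2)⁻¹ ≤ 1 + 16 / 3 * ε ^ 2 := by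
    rw [inv_le_iff_one_le_mul₀ hp]
    nlinarith [mul_nonneg (sq_nonneg ε) (by nlinarith : 0 ≤ 1 / 16 - ε ^ 2)]
  rw [coinEntropy, h2]
  linarith

/-! ### Occupation sums -/

namespace MDP

variable {S A : Type} {H : ℕ} [Fintype A]

theorem policy_ne_zero_of_pathProb_ne_zero {M : MDP S A H} {π : Policy S A} {ξ : Path S A H}
    (h : M.pathProb π ξ ≠ 0) (t : Fin H) : (π (ξ t).1).1 (ξ t).2 ≠ 0 := by
  have := Finset.prod_ne_zero_iff.1 h t (Finset.mem_univ t)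
  intro h0
  simp [h0] at this

theorem arrivalProb_ne_zero_of_pathProb_ne_zero {M : MDP S A H} {π : Policy S A} {ξ : Path S A H}
    (h : M.pathProb π ξ ≠ 0) (t : Fin H) : M.arrivalProb ξ t ≠ 0 :=
  left_ne_zero_of_mul (Finset.prod_ne_zero_iff.1 h t (Finset.mem_univ t))

variable [Fintype S]

theorem occupation_nonneg (M : MDP S A H) {w : S → ℝ} (hw : ∀ s, 0 ≤ w s) (π : Policy S A) :
    0 ≤ M.occupation w π :=
  Finset.sum_nonneg fun _ _ => mul_nonneg ENNReal.toReal_nonneg (Finset.sum_nonneg fun _ _ => hw _)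

theorem occupation_sum {ι : Type*} (M : MDP S A H) (s : Finset ι) (w : ι → S → ℝ) (π : Policy S A) :
    M.occupation (fun x => ∑ i ∈ s, w i x) π = ∑ i ∈ s, M.occupation (w i) π := by
  simp only [occupation]
  rw [Finset.sum_comm]
  refine Finset.sum_congr rfl fun ξ _ => ?_
  rw [← Finset.mul_sum, Finset.sum_comm]

theorem occupation_mul (M : MDP S A H) (c : ℝ) (w : S → ℝ) (π : Policy S A) :
    M.occupation (fun s => c * w s) π = c * M.occupation w π := by
  simp only [occupation, Finset.mul_sum]
  exact Finset.sum_congr rfl fun _ _ => Finset.sum_congr rfl fun _ _ => by ring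

theorem occupation_sub (M : MDP S A H) (v w : S → ℝ) (π : Policy S A) :
    M.occupation (fun s => v s - w s) π = M.occupation v π - M.occupation w π := by
  simp only [occupation, Finset.sum_sub_distrib, mul_sub]

theorem le_occupation (M : MDP S A H) {w : S → ℝ} {c : ℝ} (π : Policy S A)
    (h : ∀ ξ : Path S A H, M.pathProb π ξ ≠ 0 → c ≤ ∑ t, w (ξ t).1) : c ≤ M.occupation w π := by
  calc c = ∑ ξ : Path S A H, (M.pathProb π ξ).toReal * c := by
        rw [← Finset.sum_mul, sum_toReal_pathProb, one_mul]
    _ ≤ _ := Finset.sum_le_sum fun ξ _ => by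
        by_cases h0 : M.pathProb π ξ = 0
        · simp [h0]
        · exact mul_le_mul_of_nonneg_left (h ξ h0) ENNReal.toReal_nonneg

theorem occupation_eq_const (M : MDP S A H) {w : S → ℝ} {c : ℝ} (π : Policy S A)
    (h : ∀ ξ : Path S A H, M.pathProb π ξ ≠ 0 → ∑ t, w (ξ t).1 = c) : M.occupation w π = c := by
  calc M.occupation w π = ∑ ξ : Path S A H, (M.pathProb π ξ).toReal * c :=
        Finset.sum_congr rfl fun ξ _ => by
          by_cases h0 : M.pathProb π ξ = 0
          · simp [h0]
          · rw [h ξ h0]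
    _ = c := by rw [← Finset.sum_mul, sum_toReal_pathProb, one_mul]

end MDP

/-! ### Paths in the binary tree -/

/-- The leaves of the tree. -/
abbrev Leaf (K : ℕ) : Type := {s : TreeState K // IsLeaf K s}

theorem four_mul_two_pow_le {t K : ℕ} (h : t + 2 ≤ K) : 4 * 2 ^ t ≤ 2 ^ K := by
  have := Nat.pow_le_pow_right two_pos h
  rw [pow_add] at this
  omega

section Tree

variable {K : ℕ} {hK : 1 < K} {ν : Leaf K → ProbabilityMeasure ℝ}
  {π : Policy (TreeState K) Bool} {ξ : Path (TreeState K) Bool K}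

theorem path_zero (h : (treeMDP K hK ν).pathProb π ξ ≠ 0) (h0 : 0 < K) :
    ((ξ ⟨0, h0⟩).1 : ℕ) = 0 := by
  have := MDP.arrivalProb_ne_zero_of_pathProb_ne_zero h ⟨0, h0⟩
  simp only [MDP.arrivalProb, treeMDP, if_true] at this
  rw [(PMF.mem_support_pure_iff _ _).1 ((PMF.mem_support_iff _ _).2 this)]

theorem path_succ (h : (treeMDP K hK ν).pathProb π ξ ≠ 0) {t : ℕ} (ht : t + 1 < K) :
    (ξ ⟨t + 1, ht⟩).1 = child K (ξ ⟨t, Nat.lt_of_succ_lt ht⟩).1 (ξ ⟨t, Nat.lt_of_succ_lt ht⟩).2 := by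
  have := MDP.arrivalProb_ne_zero_of_pathProb_ne_zero h ⟨t + 1, ht⟩
  simp only [MDP.arrivalProb, treeMDP, Nat.succ_ne_zero, if_false] at this
  exact (PMF.mem_support_pure_iff _ _).1 ((PMF.mem_support_iff _ _).2 this)

theorem child_val {s : TreeState K} (hs : 2 * (s : ℕ) + 2 < 2 ^ K - 1) (a : Bool) :
    (child K s a : ℕ) = 2 * s + 1 + a.toNat := by
  have := Bool.toNat_le a
  rw [child, dif_pos (by omega)]

/-- In terms of `s + 1`, moving to a child appends a binary digit, so the nodes reachable at step
`t` are those for which `s + 1` has `t + 1` digits. -/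
theorem path_level (h : (treeMDP K hK ν).pathProb π ξ ≠ 0) (t : ℕ) (ht : t < K) :
    2 ^ t ≤ ((ξ ⟨t, ht⟩).1 : ℕ) + 1 ∧ ((ξ ⟨t, ht⟩).1 : ℕ) + 1 < 2 ^ (t + 1) := by
  induction t with
  | zero => rw [path_zero h]; norm_num
  | succ t ih =>
    obtain ⟨h1, h2⟩ := ih (Nat.lt_of_succ_lt ht)
    have hp := four_mul_two_pow_le (Nat.succ_le_of_lt ht)
    have := Bool.toNat_le (ξ ⟨t, Nat.lt_of_succ_lt ht⟩).2
    rw [path_succ h ht, child_val (by omega)]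
    omega

theorem isLeaf_path_iff (h : (treeMDP K hK ν).pathProb π ξ ≠ 0) (t : Fin K) :
    IsLeaf K (ξ t).1 ↔ (t : ℕ) = K - 1 := by
  obtain ⟨h1, h2⟩ := path_level h t t.2
  have ht := t.2
  simp only [Fin.eta] at h1 h2
  rw [IsLeaf]
  constructor
  · intro hl
    by_contra hne
    have := four_mul_two_pow_le (t := t) (K := K) (by omega)
    omega
  · intro hl
    have : 2 ^ K = 2 * 2 ^ (t : ℕ) := by
      rw [hl, ← pow_succ', Nat.sub_add_cancel (by omega)]
    omega

/-- Every path of positive probability meets a leaf exactly once, at its last step. This is why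
`reachProb`, defined as an expected number of visits, is a probability. -/
theorem occupation_isLeaf (hK : 1 < K) (ν : Leaf K → ProbabilityMeasure ℝ)
    (π : Policy (TreeState K) Bool) :
    (treeMDP K hK ν).occupation (fun s => if IsLeaf K s then 1 else 0) π = 1 := by
  refine MDP.occupation_eq_const _ _ fun ξ h => ?_
  have : ∀ t : Fin K, (if IsLeaf K (ξ t).1 then (1 : ℝ) else 0) =
      if t = ⟨K - 1, by omega⟩ then 1 else 0 := fun t => by
    simp only [isLeaf_path_iff h, Fin.ext_iff]
  simp [this]

/-- The probability that a leaf is reached. -/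
noncomputable def reachProb (hK : 1 < K) (ν : Leaf K → ProbabilityMeasure ℝ) (l : Leaf K)
    (π : Policy (TreeState K) Bool) : ℝ :=
  (treeMDP K hK ν).occupation (fun s => if s = l.1 then 1 else 0) π

theorem reachProb_nonneg (l : Leaf K) : 0 ≤ reachProb hK ν l π :=
  MDP.occupation_nonneg _ (fun _ => by split_ifs <;> norm_num) _

theorem sum_reachProb (hK : 1 < K) (ν : Leaf K → ProbabilityMeasure ℝ)
    (π : Policy (TreeState K) Bool) : ∑ l, reachProb hK ν l π = 1 := by
  rw [← occupation_isLeaf hK ν π]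
  simp only [reachProb]
  rw [← MDP.occupation_sum]
  congr 1
  funext s
  by_cases hs : IsLeaf K s
  · rw [if_pos hs, Finset.sum_eq_single ⟨s, hs⟩]
    · simp
    · intro l _ hl
      exact if_neg fun h => hl (Subtype.ext h.symm)
    · simp
  · rw [if_neg hs]
    exact Finset.sum_eq_zero fun l _ => if_neg fun h : s = l.1 => hs (h ▸ l.2)

theorem reachProb_le_one (l : Leaf K) : reachProb hK ν l π ≤ 1 := by
  rw [← sum_reachProb hK ν π]
  exact Finset.single_le_sum (f := fun l => reachProb hK ν l π) (fun l _ => reachProb_nonneg l)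
    (Finset.mem_univ l)

/-- The deterministic policy that follows the branch from the root to a leaf. -/
noncomputable def towards (l : Leaf K) : Policy (TreeState K) Bool := fun s =>
  -- The binary digits of `l + 1` after the leading one spell the branch to `l`; a node at level
  -- `Nat.log 2 (s + 1)` reads the next digit. At the last level the subtraction truncates to `0`,
  -- harmlessly, as no further move matters.
  ⟨Pi.single (decide ((((l.1 : ℕ) + 1) / 2 ^ (K - 1 - (Nat.log 2 (s + 1) + 1))) % 2 = 1)) 1,
    single_mem_stdSimplex ℝ _⟩

/-- The ancestors of `l` are the binary prefixes of `l + 1`. Induction on the level: the policy puts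
all its mass on the digit that extends the current prefix. -/
theorem path_towards {l : Leaf K} (h : (treeMDP K hK ν).pathProb (towards l) ξ ≠ 0) (t : ℕ)
    (ht : t < K) : ((ξ ⟨t, ht⟩).1 : ℕ) + 1 = ((l.1 : ℕ) + 1) / 2 ^ (K - 1 - t) := by
  induction t with
  | zero =>
    rw [path_zero h]
    have hl := l.2
    have hlt := l.1.2
    have hpow : 2 ^ K = 2 * 2 ^ (K - 1) := by rw [← pow_succ', Nat.sub_add_cancel (by omega)]
    rw [IsLeaf] at hl
    exact (Nat.div_eq_of_lt_le (by simp only [Nat.sub_zero]; omega)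
      (by simp only [Nat.sub_zero]; omega)).symm
  | succ t ih =>
    have ht' := Nat.lt_of_succ_lt ht
    have hlev := path_level h t ht'
    have hp := four_mul_two_pow_le (Nat.succ_le_of_lt ht)
    have hlog : Nat.log 2 (((ξ ⟨t, ht'⟩).1 : ℕ) + 1) = t :=
      Nat.log_eq_of_pow_le_of_lt_pow hlev.1 hlev.2
    have ha : (ξ ⟨t, ht'⟩).2 =
        decide ((((l.1 : ℕ) + 1) / 2 ^ (K - 1 - (t + 1))) % 2 = 1) := by
      by_contra hne
      refine MDP.policy_ne_zero_of_pathProb_ne_zero h ⟨t, ht'⟩ ?_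
      simp only [towards, hlog]
      exact Pi.single_eq_of_ne hne _
    have hdiv : ((l.1 : ℕ) + 1) / 2 ^ (K - 1 - t) = ((l.1 : ℕ) + 1) / 2 ^ (K - 1 - (t + 1)) / 2 := by
      rw [Nat.div_div_eq_div_mul, ← pow_succ]
      congr 2
      omega
    have hih := ih ht'
    rw [path_succ h ht, child_val (by omega), ha]
    rw [hdiv] at hih
    generalize ((l.1 : ℕ) + 1) / 2 ^ (K - 1 - (t + 1)) = b at *
    by_cases hb : b % 2 = 1 <;> simp only [hb, decide_true, decide_false, Bool.toNat_true,
      Bool.toNat_false] <;> omega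

theorem reachProb_towards (hK : 1 < K) (ν : Leaf K → ProbabilityMeasure ℝ) (l : Leaf K) :
    reachProb hK ν l (towards l) = 1 := by
  refine le_antisymm (reachProb_le_one l) (MDP.le_occupation _ _ fun ξ h => ?_)
  have ht : K - 1 < K := by omega
  have hl : (ξ ⟨K - 1, ht⟩).1 = l.1 := by
    have := path_towards h (K - 1) ht
    simp only [Nat.sub_self, pow_zero, Nat.div_one] at this
    exact Fin.ext (by omega)
  calc (1 : ℝ) = if (ξ ⟨K - 1, ht⟩).1 = l.1 then 1 else 0 := by rw [if_pos hl]
    _ ≤ _ := Finset.single_le_sum (f := fun t => if (ξ t).1 = l.1 then (1 : ℝ) else 0)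
      (fun t _ => by split_ifs <;> norm_num) (Finset.mem_univ _)

theorem two_pow_le_card_leaf (hK : 1 < K) : 2 ^ (K - 1) ≤ Fintype.card (Leaf K) := by
  have hpow : 2 ^ K = 2 * 2 ^ (K - 1) := by rw [← pow_succ', Nat.sub_add_cancel (by omega)]
  have hp : 0 < 2 ^ (K - 1) := by positivity
  let f : Fin (2 ^ (K - 1)) → Leaf K := fun i =>
    ⟨⟨2 ^ (K - 1) - 1 + i, by have := i.2; omega⟩, by simp only [IsLeaf]; omega⟩
  have hf : Function.Injective f := fun i j h => by
    have := congrArg (fun x : Leaf K => (x.1 : ℕ)) h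
    simp only [f] at this
    exact Fin.ext (by omega)
  simpa using Fintype.card_le_of_injective f hf

end Tree

/-! ### Instances with one planted leaf -/

theorem treeMDP_cost_leaf {K : ℕ} (hK : 1 < K) (ν : Leaf K → ProbabilityMeasure ℝ) (t : Fin K)
    (l : Leaf K) (a : Bool) : (treeMDP K hK ν).cost t l.1 a = ν l := dif_pos l.2

theorem treeMDP_cost_inner {K : ℕ} (hK : 1 < K) (ν : Leaf K → ProbabilityMeasure ℝ) (t : Fin K)
    {s : TreeState K} (hs : ¬ IsLeaf K s) (a : Bool) :
    ((treeMDP K hK ν).cost t s a : Measure ℝ) = Measure.dirac 0 :=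
  congrArg _ (dif_neg hs)

/-- All leaf costs have the law `coin p`, except that the cost of `l` has the law `coin q`. -/
noncomputable def plantedCost {K : ℕ} (p q : unitInterval) (l : Leaf K) :
    Leaf K → ProbabilityMeasure ℝ := fun l' => if l' = l then coin q else coin p

section Planted

variable {K : ℕ} (hK : 1 < K) {p q : unitInterval} {ε : ℝ}

theorem measurable_reachProb (ν : Leaf K → ProbabilityMeasure ℝ) (l : Leaf K) :
    Measurable (reachProb hK ν l) := MDP.measurable_occupation _ _

theorem hasCostDensity_planted (hp : (p : ℝ) = 1 / 2) (hq : (q : ℝ) = 1 / 2 - ε)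
    (h0 : 0 ≤ ε) (h1 : ε ≤ 1 / 4) (l : Leaf K) :
    (treeMDP K hK fun _ => coin p).HasCostDensity (treeMDP K hK (plantedCost p q l))
      (fun s x => if s = l.1 then coinDensity ε x else 1)
      (max |Real.log (1 + 2 * ε)| |Real.log (1 - 2 * ε)|) where
  init_eq := rfl
  trans_eq := rfl
  measurable s := by
    split_ifs
    exacts [measurable_coinDensity ε, measurable_const]
  pos s x := by
    unfold coinDensity
    split_ifs <;> linarith
  abs_log_le s x := by
    unfold coinDensity
    split_ifs <;> simp
  cost_eq t s a := by
    by_cases hs : IsLeaf K s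
    · lift s to Leaf K using hs
      rw [treeMDP_cost_leaf, treeMDP_cost_leaf, plantedCost]
      by_cases hl : s = l
      · simp only [hl, if_true]
        exact coin_withDensity hp hq
      · simp [hl, Subtype.coe_inj]
    · have hl : s ≠ l.1 := fun h => hs (h ▸ l.2)
      rw [treeMDP_cost_inner hK _ t hs, treeMDP_cost_inner hK _ t hs]
      simp [hl]

theorem integral_log_density_planted (hp : (p : ℝ) = 1 / 2) (l : Leaf K) (t : Fin K)
    (s : TreeState K) (a : Bool) :
    ∫ x, -Real.log (if s = l.1 then coinDensity ε x else 1)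
        ∂((treeMDP K hK fun _ => coin p).cost t s a : Measure ℝ) =
      coinEntropy ε * if s = l.1 then 1 else 0 := by
  by_cases hl : s = l.1
  · subst hl
    rw [treeMDP_cost_leaf]
    simp only [if_true, mul_one]
    exact integral_log_coinDensity hp ε
  · simp [hl]

theorem value_planted (hp : (p : ℝ) = 1 / 2) (hq : (q : ℝ) = 1 / 2 - ε) (l : Leaf K)
    (π : Policy (TreeState K) Bool) :
    (treeMDP K hK (plantedCost p q l)).value π =
      1 / 2 - ε * reachProb hK (plantedCost p q l) l π := by
  have hcost : ∀ t s a, (treeMDP K hK (plantedCost p q l)).meanCost t s a =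
      1 / 2 * (if IsLeaf K s then 1 else 0) - ε * if s = l.1 then 1 else 0 := fun t s a => by
    by_cases hs : IsLeaf K s
    · have hs' := hs
      lift s to Leaf K using hs
      rw [MDP.meanCost, treeMDP_cost_leaf, plantedCost, if_pos hs']
      by_cases hl : s = l
      · rw [if_pos hl, if_pos (congrArg _ hl), integral_coin, hq]
        ring
      · rw [if_neg hl, if_neg (Subtype.coe_injective.ne hl), integral_coin, hp]
        ring
    · have hl : s ≠ l.1 := fun h => hs (h ▸ l.2)
      rw [MDP.meanCost, treeMDP_cost_inner hK _ t hs]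
      simp [hs, hl]
  have h : (treeMDP K hK (plantedCost p q l)).value π =
      (treeMDP K hK (plantedCost p q l)).occupation
        (fun s => 1 / 2 * (if IsLeaf K s then 1 else 0) - ε * if s = l.1 then 1 else 0) π := by
    simp only [MDP.value, MDP.occupation, hcost]
  rw [h, MDP.occupation_sub, MDP.occupation_mul, MDP.occupation_mul, occupation_isLeaf, mul_one]
  rfl

theorem isOptimal_towards (hp : (p : ℝ) = 1 / 2) (hq : (q : ℝ) = 1 / 2 - ε) (h0 : 0 ≤ ε)
    (l : Leaf K) : (treeMDP K hK (plantedCost p q l)).IsOptimal (towards l) := fun π => by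
  rw [value_planted hK hp hq, value_planted hK hp hq, reachProb_towards]
  have := mul_le_mul_of_nonneg_left
    (reachProb_le_one (hK := hK) (ν := plantedCost p q l) (π := π) l) h0
  linarith

/-- The expected number of episodes in which a leaf is reached. -/
noncomputable def expectedVisits (ν : Leaf K → ProbabilityMeasure ℝ)
    (alg : Algorithm (TreeState K) Bool K) (N : ℕ) (l : Leaf K) : ℝ :=
  ∫ h, ∑ i : Fin N, reachProb hK ν l (h i).1 ∂(treeMDP K hK ν).historyLaw alg N

theorem integrable_visits (ν : Leaf K → ProbabilityMeasure ℝ)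
    (alg : Algorithm (TreeState K) Bool K) (N : ℕ) (l : Leaf K) :
    Integrable (fun h : History (TreeState K) Bool K N => ∑ i : Fin N, reachProb hK ν l (h i).1)
      ((treeMDP K hK ν).historyLaw alg N) :=
  integrable_finsetSum _ fun i _ => .of_bound ((measurable_reachProb hK ν l).comp
    (measurable_fst.comp (measurable_pi_apply i))).aestronglyMeasurable 1 (.of_forall fun h => by
      change ‖reachProb hK ν l (h i).1‖ ≤ 1
      rw [Real.norm_of_nonneg (reachProb_nonneg l)]
      exact reachProb_le_one l)

theorem sum_expectedVisits (ν : Leaf K → ProbabilityMeasure ℝ)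
    (alg : Algorithm (TreeState K) Bool K) (N : ℕ) : ∑ l, expectedVisits hK ν alg N l = N := by
  simp only [expectedVisits]
  rw [← integral_finsetSum _ fun l _ => integrable_visits hK ν alg N l]
  have : ∀ h : History (TreeState K) Bool K N,
      ∑ l, ∑ i : Fin N, reachProb hK ν l (h i).1 = N := fun h => by
    rw [Finset.sum_comm]
    simp [sum_reachProb]
  simp [this]

theorem expectedRegret_planted (hp : (p : ℝ) = 1 / 2) (hq : (q : ℝ) = 1 / 2 - ε) (l : Leaf K)
    (alg : Algorithm (TreeState K) Bool K) (N : ℕ) :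
    (treeMDP K hK (plantedCost p q l)).expectedRegret alg (towards l) N =
      ε * (N - expectedVisits hK (plantedCost p q l) alg N l) := by
  have : ∀ h : History (TreeState K) Bool K N,
      ∑ n : Fin N, ((treeMDP K hK (plantedCost p q l)).value (h n).1 -
        (treeMDP K hK (plantedCost p q l)).value (towards l)) =
      ε * (N - ∑ n : Fin N, reachProb hK (plantedCost p q l) l (h n).1) := fun h => by
    simp only [value_planted hK hp hq, reachProb_towards, Finset.mul_sum, mul_sub]
    simp only [Finset.sum_sub_distrib, Finset.sum_const, Finset.card_univ, Fintype.card_fin,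
      nsmul_eq_mul]
    ring
  simp only [MDP.expectedRegret, this, expectedVisits]
  rw [integral_const_mul, integral_sub (integrable_const _) (integrable_visits hK _ alg N l)]
  simp

theorem expectedVisits_planted_le (hp : (p : ℝ) = 1 / 2) (hq : (q : ℝ) = 1 / 2 - ε)
    (h0 : 0 ≤ ε) (h1 : ε ≤ 1 / 4) (l : Leaf K) (alg : Algorithm (TreeState K) Bool K) (N : ℕ) :
    expectedVisits hK (plantedCost p q l) alg N l ≤
      expectedVisits hK (fun _ => coin p) alg N l +
        N * (8 * (coinEntropy ε * expectedVisits hK (fun _ => coin p) alg N l) + 1 / 8) := by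
  -- The weight `r = 16` makes the error `2 / r = 1 / 8`, small enough to leave room below `3 / 4`,
  -- at the price of a factor `8` on the entropy.
  have h := (hasCostDensity_planted hK hp hq h0 h1 l).integral_sum_le
    (integral_log_density_planted hK hp l) (D := |coinEntropy ε|)
    (fun s => by split_ifs <;> simp) alg N (measurable_reachProb hK (fun _ => coin p) l)
    (fun _ => reachProb_nonneg l) (fun _ => reachProb_le_one l) (r := 16) (by norm_num)
  simp only [MDP.occupation_mul, ← Finset.mul_sum] at h
  rw [integral_const_mul] at h
  norm_num at h ⊢
  -- `reachProb` depends on the dynamics alone, so its versions for the null and the planted costs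
  -- agree by definition.
  exact h

/-- Some leaf is reached rarely when it is the one with the smaller mean. -/
theorem exists_expectedVisits_le (hp : (p : ℝ) = 1 / 2) (hq : (q : ℝ) = 1 / 2 - ε)
    (h0 : 0 ≤ ε) (h1 : ε ≤ 1 / 4) (alg : Algorithm (TreeState K) Bool K) (N : ℕ)
    (hε : (ε * N) ^ 2 ≤ Fintype.card (Leaf K) * N / 512) :
    ∃ l : Leaf K, expectedVisits hK (plantedCost p q l) alg N l ≤ 3 / 4 * N := by
  have hcard := two_pow_le_card_leaf hK
  have hL : 2 ≤ Fintype.card (Leaf K) :=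
    (Nat.pow_le_pow_right two_pos (by omega : 1 ≤ K - 1)).trans hcard
  have hL' : (2 : ℝ) ≤ Fintype.card (Leaf K) := by exact_mod_cast hL
  have : Nonempty (Leaf K) := Fintype.card_pos_iff.1 (by omega)
  have hN : (0 : ℝ) ≤ N := Nat.cast_nonneg N
  suffices h : ∑ l : Leaf K, expectedVisits hK (plantedCost p q l) alg N l ≤
      ∑ _l : Leaf K, 3 / 4 * (N : ℝ) by
    obtain ⟨l, -, hl⟩ := Finset.exists_le_of_sum_le Finset.univ_nonempty h
    exact ⟨l, hl⟩
  refine (Finset.sum_le_sum fun l _ => expectedVisits_planted_le hK hp hq h0 h1 l alg N).trans ?_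
  simp only [Finset.sum_add_distrib, ← Finset.mul_sum, sum_expectedVisits, Finset.sum_const,
    Finset.card_univ, nsmul_eq_mul]
  -- With `L` leaves the sum is at most `N + 64/3 (ε N)² + L N / 8`. The hypothesis `hε` bounds the
  -- middle term by `L N / 24`, and `L ≥ 2` gives `N ≤ L N / 2`, for a total of `2/3 L N`.
  have h2 := mul_le_mul_of_nonneg_right (coinEntropy_le h0 h1) (mul_nonneg hN hN)
  nlinarith

end Planted

end EpisodicRL

/-! ### Choice of the gap and conclusion -/

theorem theorem1 :
    ∃ c : ℝ, 0 < c ∧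
      ∀ (K : ℕ) (hK : 1 < K) (N : ℕ)
        (alg : EpisodicRL.Algorithm (EpisodicRL.TreeState K) Bool K),
        ∃ ν : {s : EpisodicRL.TreeState K // EpisodicRL.IsLeaf K s} →
            MeasureTheory.ProbabilityMeasure ℝ,
          (∀ l, (ν l : MeasureTheory.Measure ℝ) (Set.Icc 0 1) = 1) ∧
          ∃ πstar : EpisodicRL.Policy (EpisodicRL.TreeState K) Bool,
            (EpisodicRL.treeMDP K hK ν).IsOptimal πstar ∧
            c * min (Real.sqrt (((2 ^ K - 1 : ℕ) : ℝ) * (N : ℝ))) (N : ℝ) ≤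
              (EpisodicRL.treeMDP K hK ν).expectedRegret alg πstar N := by
  -- The gap will satisfy `ε N = m / 32`, and the regret is at least `ε N / 4`.
  refine ⟨1 / 128, by norm_num, fun K hK N alg => ?_⟩
  set m := min (√(((2 ^ K - 1 : ℕ) : ℝ) * (N : ℝ))) (N : ℝ) with hm
  have hm0 : 0 ≤ m := le_min (Real.sqrt_nonneg _) (Nat.cast_nonneg N)
  have hmN : m ≤ N := min_le_right _ _
  obtain ⟨ε, h0, h1, hεN⟩ : ∃ ε : ℝ, 0 ≤ ε ∧ ε ≤ 1 / 4 ∧ ε * N = m / 32 := by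
    rcases Nat.eq_zero_or_pos N with hN | hN
    · refine ⟨0, le_rfl, by norm_num, ?_⟩
      have : m = 0 := le_antisymm (by simpa [hN] using hmN) hm0
      simp [this]
    · have hN' : (0 : ℝ) < N := Nat.cast_pos.2 hN
      refine ⟨m / N / 32, by positivity, ?_, by field_simp⟩
      have := (div_le_one hN').2 hmN
      linarith
  have hS : ((2 ^ K - 1 : ℕ) : ℝ) ≤ 2 * Fintype.card (EpisodicRL.Leaf K) := by
    have hcard := EpisodicRL.two_pow_le_card_leaf hK
    have hpow : 2 ^ K = 2 * 2 ^ (K - 1) := by rw [← pow_succ', Nat.sub_add_cancel (by omega)]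
    exact_mod_cast (by omega : 2 ^ K - 1 ≤ 2 * Fintype.card (EpisodicRL.Leaf K))
  have hm2 : m ^ 2 ≤ 2 * Fintype.card (EpisodicRL.Leaf K) * N :=
    calc m ^ 2 ≤ √(((2 ^ K - 1 : ℕ) : ℝ) * (N : ℝ)) ^ 2 :=
          pow_le_pow_left₀ hm0 (min_le_left _ _) 2
      _ = ((2 ^ K - 1 : ℕ) : ℝ) * N := Real.sq_sqrt (by positivity)
      _ ≤ _ := mul_le_mul_of_nonneg_right hS (Nat.cast_nonneg N)
  let p : unitInterval := ⟨1 / 2, by norm_num, by norm_num⟩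
  let q : unitInterval := ⟨1 / 2 - ε, by linarith, by linarith⟩
  obtain ⟨l, hl⟩ := EpisodicRL.exists_expectedVisits_le hK (p := p) (q := q) rfl rfl h0 h1 alg N
    -- Here `(m / 32)² ≤ 2 L N / 1024 = L N / 512`, which is where the factor `32` comes from.
    (by rw [hεN]; linarith)
  refine ⟨EpisodicRL.plantedCost p q l, fun l' => ?_, EpisodicRL.towards l,
    EpisodicRL.isOptimal_towards hK rfl rfl h0 l, ?_⟩
  · unfold EpisodicRL.plantedCost
    split_ifs <;> exact EpisodicRL.coin_Icc _
  · rw [EpisodicRL.expectedRegret_planted hK (p := p) (q := q) rfl rfl]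
    have := mul_le_mul_of_nonneg_left hl h0
    linarith
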